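/- Let $\mathcal T^1$ be the trace class operators on $L^2(\mathbb R^d)$, and let $\langle\cdot,\cdot\rangle$ be the inner product of $L^2(\mathbb R^d)$, linear in the first entry. For $z=(x,\omega)\in\mathbb R^{2d}$ let $\pi(z)\psi(t)=e^{2\pi i\omega\cdot t}\psi(t-x)$. For $S\in\mathcal T^1$ and $f\in L^1(\mathbb R^{2d})$ put $$\mathcal F_W(S)(z)=e^{-\pi i x\cdot\omega}\,\mathrm{tr}(\pi(-z)S),\qquad f\star S=\int_{\mathbb R^{2d}} f(y)\,\pi(y)S\pi(y)^*\,dy ,$$ and for $\varphi_1,\varphi_2\in L^2(\mathbb R^d)$ put $$V_{\varphi_1}\psi(z)=\langle\psi,\pi(z)\varphi_1\rangle,\qquad A(\varphi_2,\varphi_1)(z)=e^{\pi i x\cdot\omega}\,V_{\varphi_1}\varphi_2(z),\qquad \mathcal A_\Omega^{\varphi_1,\varphi_2}\psi=\int_{\mathbb R^{2d}} \chi_\Omega(z)\,V_{\varphi_1}\psi(z)\,\pi(z)\varphi_2\,dz ,$$ where the operator- and vector-valued integrals are understood weakly and $\chi_\Omega$ is the characteristic function of $\Omega$. Let $\mu$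 be Lebesgue measure on $\mathbb R^{2d}$. 1. Let $S\in\mathcal T^1$ be such that $\{z\in\mathbb R^{2d}:\mathcal F_W(S)(z)=0\}$ has dense complement in $\mathbb R^{2d}$. Then any measurable $\Omega\subset\mathbb R^{2d}$ with finite Lebesgue measure is uniquely determined, among such sets and up to Lebesgue measure zero, by the operator $\chi_\Omega\star S$: if $\mu(\Omega),\mu(\Omega')<\infty$ and $\chi_\Omega\star S=\chi_{\Omega'}\star S$, then $\mu(\Omega\triangle\Omega')=0$. 2. Let $\varphi_1,\varphi_2\in L^2(\mathbb R^d)$ be such that $\{z\in\mathbb R^{2d}:A(\varphi_2,\varphi_1)(z)=0\}$ has dense complement in $\mathbb R^{2d}$. Then any measurable $\Omega\subset\mathbb R^{2d}$ with finite Lebesgue measure is uniquely determined, among such sets and up to Lebesgue measure zero, by the operator $\mathcal A_\Omega^{\varphi_1,\varphi_2}$: if $\mu(\Omega),\mu(\Omega')<\infty$ and $\mathcal A_\Omega^{\varphi_1,\varphi_2}=\mathcal A_{\Omega'}^{\varphi_1,\varphi_2}$, then $\mu(\Omega\triangle\Omega')=0$. -/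

import Mathlib

open MeasureTheory
open scoped symmDiff

noncomputable section

namespace QHA

/-- The Hilbert space `L²(ℝᵈ)` of complex-valued functions, with respect to Lebesgue measure. -/
abbrev L2 (d : ℕ) : Type :=
  Lp ℂ 2 (volume : Measure (EuclideanSpace ℝ (Fin d)))

/-- Phase space `ℝ²ᵈ`, with elements `z = (x, ω)`. Its `volume` is Lebesgue measure. -/
abbrev Phase (d : ℕ) : Type :=
  EuclideanSpace ℝ (Fin d) × EuclideanSpace ℝ (Fin d)

/-! ### Trace class operators and the trace -/

section TraceClass

variable {H : Type*} [NormedAddCommGroup H] [InnerProductSpace ℂ H] [CompleteSpace H]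

/-- `S = ∑ₙ sₙ ψₙ ⊗ φₙ` (convergent in operator norm) is a singular value decomposition of `S`:
the `sₙ` are positive and `(ψₙ)`, `(φₙ)` are orthonormal. The (finite or infinite) index set `N` is
a set of natural numbers. Here `rankOne ℂ ψ φ` is the operator `ψ ⊗ φ : ζ ↦ ⟨ζ, φ⟩ ψ`. -/
structure IsSVD (S : H →L[ℂ] H) (N : Set ℕ) (s : N → ℝ) (ψ φ : N → H) : Prop where
  pos : ∀ n, 0 < s n
  orthonormal_left : Orthonormal ℂ ψ
  orthonormal_right : Orthonormal ℂ φ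
  hasSum : HasSum (fun n => (s n : ℂ) • InnerProductSpace.rankOne ℂ (ψ n) (φ n)) S

/-- `S` is of trace class: it is compact and its singular values are summable. -/
def IsTraceClass (S : H →L[ℂ] H) : Prop :=
  IsCompactOperator S ∧
    ∃ (N : Set ℕ) (s : N → ℝ) (ψ φ : N → H), IsSVD S N s ψ φ ∧ Summable s

/-- The trace `tr S = ∑ₑ ⟨S e, e⟩`, the sum being over an orthonormal basis. (For trace class
operators, the sum converges absolutely and does not depend on the basis.) -/
def trace (S : H →L[ℂ] H) : ℂ :=
  ∑' e : (exists_hilbertBasis ℂ H).choose, inner ℂ (e : H) (S (e : H))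

/-- The weak integral `∫ G(z) dz` of an operator-valued function: the operator `A` with
`⟨A ψ, φ⟩ = ∫ ⟨G(z) ψ, φ⟩ dz` for all `ψ`, `φ`. (It is `0` if there is no such operator or if one of
these functions is not integrable.) -/
def operatorIntegral {X : Type*} [MeasurableSpace X] (μ : Measure X) (G : X → H →L[ℂ] H) :
    H →L[ℂ] H :=
  open scoped Classical in
  if h : ∃ A : H →L[ℂ] H, ∀ ψ φ : H, Integrable (fun z => inner ℂ φ (G z ψ)) μ ∧
      inner ℂ φ (A ψ) = ∫ z, inner ℂ φ (G z ψ) ∂μ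
  then h.choose else 0

/-- The weak integral exists whenever `G` is weakly measurable with integrably bounded norm. -/
theorem operatorIntegral_spec {X : Type*} [MeasurableSpace X] {μ : Measure X}
    {G : X → H →L[ℂ] H} {b : X → ℝ} (hb : Integrable b μ) (hGb : ∀ z, ‖G z‖ ≤ b z)
    (hG : ∀ ψ φ : H, AEStronglyMeasurable (fun z => inner ℂ φ (G z ψ)) μ) (ψ φ : H) :
    Integrable (fun z => inner ℂ φ (G z ψ)) μ ∧
      inner ℂ φ (operatorIntegral μ G ψ) = ∫ z, inner ℂ φ (G z ψ) ∂μ := by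
  have hbd : ∀ (ψ φ : H) z, ‖inner ℂ φ (G z ψ)‖ ≤ b z * (‖ψ‖ * ‖φ‖) := by
    intro ψ φ z
    calc ‖inner ℂ φ (G z ψ)‖ ≤ ‖φ‖ * ‖G z ψ‖ := norm_inner_le_norm _ _
      _ ≤ ‖φ‖ * (b z * ‖ψ‖) := by
        gcongr
        exact (G z).le_of_opNorm_le (hGb z) ψ
      _ = b z * (‖ψ‖ * ‖φ‖) := by ring
  have hint : ∀ ψ φ : H, Integrable (fun z => inner ℂ φ (G z ψ)) μ := fun ψ φ =>
    (hb.mul_const _).mono' (hG ψ φ) (Filter.Eventually.of_forall (hbd ψ φ))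
  have hint' : ∀ ψ φ : H, Integrable (fun z => inner ℂ (G z ψ) φ) μ := by
    intro ψ φ
    have := (Complex.conjLIE.toContinuousLinearEquiv.toContinuousLinearMap).integrable_comp
      (hint ψ φ)
    simpa [inner_conj_symm] using this
  have hex : ∃ A : H →L[ℂ] H, ∀ ψ φ : H, Integrable (fun z => inner ℂ φ (G z ψ)) μ ∧
      inner ℂ φ (A ψ) = ∫ z, inner ℂ φ (G z ψ) ∂μ := by
    let B : H →ₗ⋆[ℂ] H →ₗ[ℂ] ℂ := LinearMap.mk₂'ₛₗ (starRingEnd ℂ) (RingHom.id ℂ)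
      (fun ψ φ => ∫ z, inner ℂ (G z ψ) φ ∂μ)
      (fun a b c => by
        simp only [map_add, inner_add_left]
        exact integral_add (hint' _ _) (hint' _ _))
      (fun r a c => by
        simp only [map_smul, inner_smul_left, smul_eq_mul]
        exact integral_const_mul _ _)
      (fun a b c => by
        simp only [inner_add_right]
        exact integral_add (hint' _ _) (hint' _ _))
      (fun r a c => by
        simp only [inner_smul_right, smul_eq_mul, RingHom.id_apply]
        exact integral_const_mul _ _)
    let B' : H →L⋆[ℂ] H →L[ℂ] ℂ := B.mkContinuous₂ (∫ z, b z ∂μ) (fun ψ φ => by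
      change ‖∫ z, inner ℂ (G z ψ) φ ∂μ‖ ≤ _
      rw [mul_assoc, ← integral_mul_const]
      refine norm_integral_le_of_norm_le (hb.mul_const _) (Filter.Eventually.of_forall fun z => ?_)
      rw [norm_inner_symm]
      exact hbd ψ φ z)
    refine ⟨InnerProductSpace.continuousLinearMapOfBilin B', fun ψ φ => ⟨hint ψ φ, ?_⟩⟩
    rw [← inner_conj_symm, InnerProductSpace.continuousLinearMapOfBilin_apply]
    change (starRingEnd ℂ) (∫ z, inner ℂ (G z ψ) φ ∂μ) = _
    rw [← integral_conj]
    simp only [inner_conj_symm]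
  rw [operatorIntegral, dif_pos hex]
  exact hex.choose_spec ψ φ

end TraceClass

/-! ### Time-frequency shifts -/

variable {d : ℕ}

/-- The translation operator `(T_x ψ)(t) = ψ(t - x)` on `L²(ℝᵈ)`. -/
def translation (x : EuclideanSpace ℝ (Fin d)) : L2 d →ₗᵢ[ℂ] L2 d :=
  Lp.compMeasurePreservingₗᵢ ℂ (fun t => t - x) (measurePreserving_sub_right volume x)

/-- The character `t ↦ exp(2πi ω·t)` of `ℝᵈ`. -/
def character (ω t : EuclideanSpace ℝ (Fin d)) : ℂ :=
  Complex.exp (2 * Real.pi * Complex.I * (inner ℝ ω t : ℝ))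

theorem norm_character (ω t : EuclideanSpace ℝ (Fin d)) : ‖character ω t‖ = 1 := by
  rw [character, show (2 * Real.pi * Complex.I * (inner ℝ ω t : ℝ) : ℂ)
    = ((2 * Real.pi * inner ℝ ω t : ℝ) : ℂ) * Complex.I by push_cast; ring]
  exact Complex.norm_exp_ofReal_mul_I _

theorem continuous_character :
    Continuous fun p : EuclideanSpace ℝ (Fin d) × EuclideanSpace ℝ (Fin d) =>
      character p.1 p.2 := by
  unfold character
  fun_prop

theorem memLp_character_mul (ω : EuclideanSpace ℝ (Fin d)) (f : L2 d) :
    MemLp (fun t => character ω t * f t) 2 volume := by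
  refine (Lp.memLp f).of_le ?_ (Filter.Eventually.of_forall fun t => ?_)
  · exact (continuous_character.comp (Continuous.prodMk_right ω)).aestronglyMeasurable.mul
      (Lp.aestronglyMeasurable f)
  · rw [norm_mul, norm_character, one_mul]

/-- The modulation operator `(M_ω ψ)(t) = exp(2πi ω·t) ψ(t)` on `L²(ℝᵈ)`. -/
def modulation (ω : EuclideanSpace ℝ (Fin d)) : L2 d →ₗᵢ[ℂ] L2 d where
  toFun f := (memLp_character_mul ω f).toLp _
  map_add' f g := by
    rw [← MemLp.toLp_add]
    refine MemLp.toLp_congr _ _ ?_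
    filter_upwards [Lp.coeFn_add f g] with t ht
    simp only [Pi.add_apply] at ht ⊢
    rw [← mul_add, ← ht]
  map_smul' c f := by
    rw [RingHom.id_apply, ← MemLp.toLp_const_smul]
    refine MemLp.toLp_congr _ _ ?_
    filter_upwards [Lp.coeFn_smul c f] with t ht
    simp [ht, mul_left_comm]
  norm_map' f := by
    refine le_antisymm (Lp.norm_le_norm_of_ae_le ?_) (Lp.norm_le_norm_of_ae_le ?_) <;>
    · filter_upwards [(memLp_character_mul ω f).coeFn_toLp] with t ht
      simp only [LinearMap.coe_mk, AddHom.coe_mk]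
      rw [ht, norm_mul, norm_character, one_mul]

/-- The time-frequency shift `π(z) = M_ω T_x` for `z = (x, ω)`. -/
def tfShift (z : Phase d) : L2 d →L[ℂ] L2 d :=
  ((modulation z.2).comp (translation z.1)).toContinuousLinearMap

/-- The shift of operators `α_z(A) = π(z) A π(z)^*`. -/
def opShift (z : Phase d) (A : L2 d →L[ℂ] L2 d) : L2 d →L[ℂ] L2 d :=
  tfShift z ∘L A ∘L (tfShift z).adjoint

/-! ### Ambiguity function, Fourier-Wigner transform, convolutions, localization operators -/

/-- The short-time Fourier transform `V_φ ψ(z) = ⟨ψ, π(z) φ⟩`; the bracket is linear in its first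
entry, so it is `inner ℂ (π(z) φ) ψ`. -/
def stft (φ ψ : L2 d) (z : Phase d) : ℂ :=
  inner ℂ (tfShift z φ) ψ

/-- The cross-ambiguity function `A(ψ, φ)(z) = exp(πi x·ω) V_φ ψ(z)`. -/
def ambiguity (ψ φ : L2 d) (z : Phase d) : ℂ :=
  Complex.exp (Real.pi * Complex.I * (inner ℝ z.1 z.2 : ℝ)) * stft φ ψ z

/-- The Fourier-Wigner transform `F_W S(z) = exp(-πi x·ω) tr(π(-z) S)`. -/
def fourierWigner (S : L2 d →L[ℂ] L2 d) (z : Phase d) : ℂ :=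
  Complex.exp (-(Real.pi * Complex.I * (inner ℝ z.1 z.2 : ℝ))) * trace (tfShift (-z) ∘L S)

/-- The convolution `f ⋆ S = ∫ f(y) α_y(S) dy`, a weak integral over `ℝ²ᵈ`. -/
def conv (f : Phase d → ℂ) (S : L2 d →L[ℂ] L2 d) : L2 d →L[ℂ] L2 d :=
  operatorIntegral volume fun y => f y • opShift y S

/-- The localization operator `A_f^{φ₁,φ₂} ψ = ∫ f(z) V_{φ₁}ψ(z) π(z)φ₂ dz`, a weak integral over
`ℝ²ᵈ`. The integrand is the operator `ψ ↦ f(z) ⟨ψ, π(z)φ₁⟩ π(z)φ₂`. -/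
def localizationOperator (f : Phase d → ℂ) (φ₁ φ₂ : L2 d) : L2 d →L[ℂ] L2 d :=
  operatorIntegral volume fun z =>
    f z • InnerProductSpace.rankOne ℂ (tfShift z φ₂) (tfShift z φ₁)

/-- The characteristic function of `Ω`, with complex values. -/
def chi (Ω : Set (Phase d)) : Phase d → ℂ :=
  Ω.indicator fun _ => 1

/-! ### The weak integrals above exist for integrable `f` -/

theorem norm_tfShift_apply (z : Phase d) (f : L2 d) : ‖tfShift z f‖ = ‖f‖ :=
  LinearIsometry.norm_map _ f

theorem norm_tfShift_le (z : Phase d) : ‖tfShift z‖ ≤ 1 :=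
  ContinuousLinearMap.opNorm_le_bound _ zero_le_one fun f => by
    rw [norm_tfShift_apply, one_mul]

theorem coeFn_modulation (ω : EuclideanSpace ℝ (Fin d)) (f : L2 d) :
    modulation ω f =ᵐ[volume] fun t => character ω t * f t :=
  (memLp_character_mul ω f).coeFn_toLp

theorem coeFn_translation (x : EuclideanSpace ℝ (Fin d)) (f : L2 d) :
    translation x f =ᵐ[volume] fun t => f (t - x) :=
  Lp.coeFn_compMeasurePreserving f (measurePreserving_sub_right volume x)

theorem modulation_neg_cancel (ω : EuclideanSpace ℝ (Fin d)) (f : L2 d) :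
    modulation ω (modulation (-ω) f) = f := by
  refine Lp.ext ?_
  filter_upwards [coeFn_modulation ω (modulation (-ω) f), coeFn_modulation (-ω) f] with t h1 h2
  rw [h1, h2, ← mul_assoc, character, character, ← Complex.exp_add]
  simp

theorem translation_neg_cancel (x : EuclideanSpace ℝ (Fin d)) (f : L2 d) :
    translation x (translation (-x) f) = f := by
  refine Lp.ext ?_
  have h := (measurePreserving_sub_right volume x).quasiMeasurePreserving.ae_eq_comp
    (coeFn_translation (-x) f)
  filter_upwards [coeFn_translation x (translation (-x) f), h] with t h1 h2
  rw [h1]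
  simpa using h2

theorem norm_adjoint_tfShift_apply (z : Phase d) (f : L2 d) :
    ‖(tfShift z).adjoint f‖ = ‖f‖ := by
  have hs : ∃ g, tfShift z g = f := by
    refine ⟨translation (-z.1) (modulation (-z.2) f), ?_⟩
    change modulation z.2 (translation z.1 _) = f
    rw [translation_neg_cancel, modulation_neg_cancel]
  obtain ⟨g, rfl⟩ := hs
  have : (tfShift z).adjoint (tfShift z g) = g := by
    refine ext_inner_left ℂ fun v => ?_
    rw [ContinuousLinearMap.adjoint_inner_right]
    exact LinearIsometry.inner_map_map _ v g
  rw [this, norm_tfShift_apply]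

/-- A norm-preserving weakly continuous family is strongly continuous. -/
theorem continuous_of_weak {X : Type*} [TopologicalSpace X] {u : X → L2 d} {c : ℝ}
    (hn : ∀ x, ‖u x‖ = c) (hw : ∀ g : L2 d, Continuous fun x => inner ℂ g (u x)) :
    Continuous u := by
  rw [continuous_iff_continuousAt]
  intro x₀
  rw [ContinuousAt, tendsto_iff_norm_sub_tendsto_zero]
  have h1 : ∀ x, ‖u x - u x₀‖ = √(2 * c ^ 2 - 2 * RCLike.re (inner ℂ (u x₀) (u x))) := by
    intro x
    rw [← Real.sqrt_sq (norm_nonneg (u x - u x₀)), norm_sub_sq (𝕜 := ℂ), hn, hn,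
      inner_re_symm]
    ring_nf
  simp only [h1]
  have h2 : Continuous fun x => √(2 * c ^ 2 - 2 * RCLike.re (inner ℂ (u x₀) (u x))) := by
    have := hw (u x₀)
    fun_prop
  have h3 := h2.tendsto x₀
  rw [← h1 x₀, sub_self, norm_zero] at h3
  exact h3

theorem continuous_translation (f : L2 d) : Continuous fun x => translation x f := by
  let g : EuclideanSpace ℝ (Fin d) → C(EuclideanSpace ℝ (Fin d), EuclideanSpace ℝ (Fin d)) :=
    fun x => ⟨fun t => t - x, by fun_prop⟩
  have hg : Continuous g := ContinuousMap.continuous_of_continuous_uncurry _ (by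
    change Continuous fun p : EuclideanSpace ℝ (Fin d) × EuclideanSpace ℝ (Fin d) => p.2 - p.1
    fun_prop)
  exact Continuous.compMeasurePreservingLp (p := 2) (continuous_const (y := f)) hg
    (fun x => measurePreserving_sub_right volume x) (by simp)

theorem continuous_modulation (f : L2 d) : Continuous fun ω => modulation ω f := by
  refine continuous_of_weak (fun ω => (modulation ω).norm_map f) fun g => ?_
  have h : ∀ ω, inner ℂ g (modulation ω f) = ∫ t, character ω t * inner ℂ (g t) (f t) := by
    intro ω
    rw [L2.inner_def]
    refine integral_congr_ae ?_
    filter_upwards [coeFn_modulation ω f] with t ht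
    rw [ht, ← smul_eq_mul, inner_smul_right]
  simp only [h]
  have hint : Integrable (fun t => inner ℂ (g t) (f t)) volume := L2.integrable_inner g f
  refine continuous_of_dominated (bound := fun t => ‖inner ℂ (g t) (f t)‖) ?_ ?_ hint.norm ?_
  · intro ω
    exact (continuous_character.comp (Continuous.prodMk_right ω)).aestronglyMeasurable.mul
      hint.aestronglyMeasurable
  · intro ω
    refine Filter.Eventually.of_forall fun t => ?_
    rw [norm_mul, norm_character, one_mul]
  · refine Filter.Eventually.of_forall fun t => ?_
    exact (continuous_character.comp (Continuous.prodMk_left t)).mul continuous_const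

/-- Time-frequency shifts are strongly continuous. -/
theorem continuous_tfShift (f : L2 d) : Continuous fun z : Phase d => tfShift z f := by
  rw [continuous_iff_continuousAt]
  intro z₀
  rw [ContinuousAt, tendsto_iff_norm_sub_tendsto_zero]
  have h1 : Continuous fun z : Phase d => ‖translation z.1 f - translation z₀.1 f‖ +
      ‖modulation z.2 (translation z₀.1 f) - modulation z₀.2 (translation z₀.1 f)‖ := by
    have a := (continuous_translation f).comp (continuous_fst (X := EuclideanSpace ℝ (Fin d))
      (Y := EuclideanSpace ℝ (Fin d)))
    have b := (continuous_modulation (translation z₀.1 f)).comp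
      (continuous_snd (X := EuclideanSpace ℝ (Fin d)) (Y := EuclideanSpace ℝ (Fin d)))
    exact (a.sub continuous_const).norm.add (b.sub continuous_const).norm
  have h2 := h1.tendsto z₀
  simp only [sub_self, norm_zero, add_zero] at h2
  refine squeeze_zero (fun _ => norm_nonneg _) (fun z => ?_) h2
  change ‖modulation z.2 (translation z.1 f) - modulation z₀.2 (translation z₀.1 f)‖ ≤ _
  refine (norm_sub_le_norm_sub_add_norm_sub _ (modulation z.2 (translation z₀.1 f)) _).trans ?_
  rw [← map_sub, LinearIsometry.norm_map]

theorem continuous_adjoint_tfShift (f : L2 d) :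
    Continuous fun z : Phase d => (tfShift z).adjoint f := by
  refine continuous_of_weak (fun z => norm_adjoint_tfShift_apply z f) fun g => ?_
  simp only [ContinuousLinearMap.adjoint_inner_right]
  exact (continuous_tfShift g).inner continuous_const

/-- For integrable `f`, the operator `f ⋆ S` satisfies its defining weak identity. -/
theorem conv_spec {f : Phase d → ℂ} (hf : Integrable f volume) (S : L2 d →L[ℂ] L2 d)
    (ψ φ : L2 d) :
    Integrable (fun y => f y * inner ℂ φ (opShift y S ψ)) volume ∧
      inner ℂ φ (conv f S ψ) = ∫ y, f y * inner ℂ φ (opShift y S ψ) := by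
  have key := operatorIntegral_spec (μ := (volume : Measure (Phase d)))
    (G := fun y => f y • opShift y S) (b := fun y => ‖f y‖ * ‖S‖) (hf.norm.mul_const _) ?_ ?_ ψ φ
  · simpa only [conv, smul_apply, inner_smul_right] using key
  · intro y
    rw [norm_smul]
    gcongr
    refine ContinuousLinearMap.opNorm_le_bound _ (norm_nonneg _) fun v => ?_
    change ‖tfShift y (S ((tfShift y).adjoint v))‖ ≤ _
    rw [norm_tfShift_apply, ← norm_adjoint_tfShift_apply y v]
    exact S.le_opNorm _
  · intro v w
    simp only [smul_apply, inner_smul_right]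
    refine hf.aestronglyMeasurable.mul (Continuous.aestronglyMeasurable ?_)
    have h : ∀ y : Phase d, inner ℂ w (opShift y S v) =
        inner ℂ ((tfShift y).adjoint w) (S ((tfShift y).adjoint v)) := fun y =>
      ((tfShift y).adjoint_inner_left _ _).symm
    simp only [h]
    exact (continuous_adjoint_tfShift w).inner (S.continuous.comp (continuous_adjoint_tfShift v))

/-- For integrable `f`, the localization operator satisfies its defining weak identity
`⟨A_f^{φ₁,φ₂} ψ, φ⟩ = ∫ f(z) V_{φ₁}ψ(z) ⟨π(z)φ₂, φ⟩ dz`. -/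
theorem localizationOperator_spec {f : Phase d → ℂ} (hf : Integrable f volume) (φ₁ φ₂ : L2 d)
    (ψ φ : L2 d) :
    Integrable (fun z => f z * stft φ₁ ψ z * inner ℂ φ (tfShift z φ₂)) volume ∧
      inner ℂ φ (localizationOperator f φ₁ φ₂ ψ) =
        ∫ z, f z * stft φ₁ ψ z * inner ℂ φ (tfShift z φ₂) := by
  have key := operatorIntegral_spec (μ := (volume : Measure (Phase d)))
    (G := fun z => f z • InnerProductSpace.rankOne ℂ (tfShift z φ₂) (tfShift z φ₁))
    (b := fun z => ‖f z‖ * (‖φ₂‖ * ‖φ₁‖)) (hf.norm.mul_const _) ?_ ?_ ψ φ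
  · simpa only [localizationOperator, stft, smul_apply, inner_smul_right,
      InnerProductSpace.rankOne_apply, mul_assoc] using key
  · intro z
    rw [norm_smul, InnerProductSpace.norm_rankOne, norm_tfShift_apply, norm_tfShift_apply]
  · intro v w
    simp only [smul_apply, inner_smul_right, InnerProductSpace.rankOne_apply]
    refine hf.aestronglyMeasurable.mul (Continuous.aestronglyMeasurable ?_)
    exact ((continuous_tfShift φ₁).inner continuous_const).mul
      (continuous_const.inner (continuous_tfShift φ₂))

theorem integrable_chi {Ω : Set (Phase d)} (hΩ : NullMeasurableSet Ω volume)
    (hfin : volume Ω < ⊤) : Integrable (chi Ω) volume := by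
  refine IntegrableOn.integrable_indicator₀ ?_ hΩ
  exact integrableOn_const hfin.ne

end QHA

end

/-!
The idea is that the Fourier-Wigner transform turns the convolution `f ⋆ S` into a product. Since
`π(-z) π(y) = exp(2πi σ(y, z)) π(y) π(-z)` with the symplectic form `σ`, and the trace is invariant
under conjugation by the unitary `π(y)`,

  `tr(π(-z) (f ⋆ S)) = (∫ f(y) exp(2πi σ(y, z)) dy) · tr(π(-z) S)`

(`QHA.hasSum_trace_tfShift_conv`). Because `f ⋆ S` is only a weak integral, the trace is computed
in an orthonormal basis, and the sum over the basis is exchanged with the integral by dominated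
convergence. The domination comes from a representation `S = ∑ₙ ψₙ ⊗ φₙ` with
`∑ₙ ‖ψₙ‖ ‖φₙ‖ < ∞` (`QHA.IsNuclearRep`): the partial sums of the trace of any of the conjugated
operators are bounded by this number (`QHA.IsNuclearRep.norm_sum_inner_le`). The same representation
gives `tr S = ∑ₙ ⟨ψₙ, φₙ⟩` (`QHA.IsNuclearRep.hasSum_trace`), from which the invariance is clear.

Hence, if `χ_Ω ⋆ S = χ_Ω' ⋆ S`, the finite measures `μ|_Ω` and `μ|_Ω'` have the same symplectic
Fourier transform wherever the Fourier-Wigner transform of `S` does not vanish, that is, on a dense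
set. These transforms are continuous, so they agree everywhere; a finite measure is determined by its
Fourier transform (`QHA.measure_ext_of_integral_sympChar`), so `μ|_Ω = μ|_Ω'`.

The statement on localization operators is the special case `S = φ₂ ⊗ φ₁`: then
`𝒜_Ω = χ_Ω ⋆ S` (`QHA.localizationOperator_eq_conv`) and the Fourier-Wigner transform of `S` is the
cross-ambiguity function `A(φ₂, φ₁)` (`QHA.fourierWigner_rankOne`).
-/

noncomputable section

open Filter Topology

namespace QHA

/-! ### Nuclear representations and the trace -/

section Nuclear

variable {H : Type*} [NormedAddCommGroup H] [InnerProductSpace ℂ H]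

/-- `T = ∑ₙ ψₙ ⊗ φₙ` with `∑ₙ ‖ψₙ‖ ‖φₙ‖ < ∞`, the first series converging
pointwise. Neither orthogonality nor a normalization is asked of `ψₙ` and `φₙ`, so that the notion is
stable under composition with bounded operators. -/
structure IsNuclearRep {N : Type*} (T : H →L[ℂ] H) (ψ φ : N → H) : Prop where
  summable : Summable fun n => ‖ψ n‖ * ‖φ n‖
  hasSum : ∀ v, HasSum (fun n => inner ℂ (φ n) v • ψ n) (T v)

variable {N : Type*} {T : H →L[ℂ] H} {ψ φ : N → H}

theorem isNuclearRep_rankOne (ψ φ : H) :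
    IsNuclearRep (InnerProductSpace.rankOne ℂ ψ φ) (fun _ : Unit => ψ) fun _ => φ where
  summable := (hasSum_fintype _).summable
  hasSum v := by
    convert hasSum_fintype (fun _ : Unit => inner ℂ φ v • ψ) using 1
    simp [InnerProductSpace.rankOne_apply]

theorem IsNuclearRep.comp_left (h : IsNuclearRep T ψ φ) (A : H →L[ℂ] H) :
    IsNuclearRep (A ∘L T) (fun n => A (ψ n)) φ where
  summable := by
    refine Summable.of_nonneg_of_le (fun n => by positivity) (fun n => ?_)
      (h.summable.mul_left ‖A‖)
    rw [← mul_assoc]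
    gcongr
    exact A.le_opNorm _
  hasSum v := by
    simpa only [map_smul, ContinuousLinearMap.comp_apply] using (h.hasSum v).mapL A

theorem IsNuclearRep.comp_adjoint [CompleteSpace H] (h : IsNuclearRep T ψ φ) (A : H →L[ℂ] H) :
    IsNuclearRep (T ∘L A.adjoint) ψ (fun n => A (φ n)) where
  summable := by
    refine Summable.of_nonneg_of_le (fun n => by positivity) (fun n => ?_)
      (h.summable.mul_left ‖A‖)
    rw [mul_left_comm]
    gcongr
    exact A.le_opNorm _
  hasSum v := by
    simpa only [ContinuousLinearMap.adjoint_inner_right, ContinuousLinearMap.comp_apply]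
      using h.hasSum (A.adjoint v)

/-- Absorbing the singular values into the left vectors turns a singular value decomposition into a
nuclear representation. -/
theorem IsSVD.isNuclearRep {S : H →L[ℂ] H} [CompleteSpace H] {N : Set ℕ} {s : N → ℝ}
    {ψ φ : N → H} (h : IsSVD S N s ψ φ) (hs : Summable s) :
    IsNuclearRep S (fun n => (s n : ℂ) • ψ n) φ where
  summable := by
    refine hs.congr fun n => ?_
    rw [norm_smul, h.orthonormal_left.1, h.orthonormal_right.1, Complex.norm_real,
      Real.norm_of_nonneg (h.pos n).le]
    simp
  hasSum v := by
    convert h.hasSum.mapL (ContinuousLinearMap.apply ℂ H v) using 2 with n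
    · exact smul_comm _ _ _
    · rfl

theorem IsTraceClass.exists_isNuclearRep [CompleteSpace H] {S : H →L[ℂ] H}
    (hS : IsTraceClass S) : ∃ (N : Set ℕ) (ψ φ : N → H), IsNuclearRep S ψ φ := by
  obtain ⟨-, N, s, ψ, φ, h, hs⟩ := hS
  exact ⟨N, _, _, h.isNuclearRep hs⟩

/-- Cauchy-Schwarz and Bessel's inequality, for a finite part of an orthonormal family. -/
theorem sum_norm_inner_mul_inner_le {ι : Type*} {b : ι → H} (hb : Orthonormal ℂ b) (x y : H)
    (F : Finset ι) : ∑ i ∈ F, ‖inner ℂ x (b i) * inner ℂ (b i) y‖ ≤ ‖x‖ * ‖y‖ := by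
  simp only [norm_mul]
  refine (Real.sum_mul_le_sqrt_mul_sqrt _ _ _).trans ?_
  gcongr
  · refine Real.sqrt_le_iff.2 ⟨norm_nonneg _, ?_⟩
    simp only [norm_inner_symm x]
    exact hb.sum_inner_products_le _
  · exact Real.sqrt_le_iff.2 ⟨norm_nonneg _, hb.sum_inner_products_le _⟩

theorem IsNuclearRep.hasSum_inner (h : IsNuclearRep T ψ φ) (x v : H) :
    HasSum (fun n => inner ℂ (φ n) v * inner ℂ x (ψ n)) (inner ℂ x (T v)) := by
  simpa only [innerSL_apply_apply, inner_smul_right] using (h.hasSum v).mapL (innerSL ℂ x)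

theorem IsNuclearRep.hasSum_sum_inner (h : IsNuclearRep T ψ φ) {ι : Type*} (b : ι → H)
    (F : Finset ι) :
    HasSum (fun n => ∑ i ∈ F, inner ℂ (φ n) (b i) * inner ℂ (b i) (ψ n))
      (∑ i ∈ F, inner ℂ (b i) (T (b i))) :=
  hasSum_sum fun i _ => h.hasSum_inner (b i) (b i)

/-- The partial sums of the trace are bounded uniformly in the orthonormal family. -/
theorem IsNuclearRep.norm_sum_inner_le (h : IsNuclearRep T ψ φ) {ι : Type*} {b : ι → H}
    (hb : Orthonormal ℂ b) (F : Finset ι) :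
    ‖∑ i ∈ F, inner ℂ (b i) (T (b i))‖ ≤ ∑' n, ‖ψ n‖ * ‖φ n‖ := by
  rw [← (h.hasSum_sum_inner b F).tsum_eq]
  refine tsum_of_norm_bounded h.summable.hasSum fun n => ?_
  rw [mul_comm]
  exact (norm_sum_le _ _).trans (sum_norm_inner_mul_inner_le hb _ _ F)

/-- The trace of `∑ₙ ψₙ ⊗ φₙ` in any orthonormal basis is `∑ₙ ⟨ψₙ, φₙ⟩`. -/
theorem IsNuclearRep.hasSum_trace [CompleteSpace H] (h : IsNuclearRep T ψ φ) {ι : Type*}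
    (b : HilbertBasis ι ℂ H) :
    HasSum (fun i => inner ℂ (b i) (T (b i))) (∑' n, inner ℂ (φ n) (ψ n)) := by
  have key : Tendsto (fun F : Finset ι => ∑' n, ∑ i ∈ F, inner ℂ (φ n) (b i) * inner ℂ (b i) (ψ n))
      atTop (𝓝 (∑' n, inner ℂ (φ n) (ψ n))) := by
    refine tendsto_tsum_of_dominated_convergence h.summable
      (fun n => b.hasSum_inner_mul_inner (φ n) (ψ n)) (Eventually.of_forall fun F n => ?_)
    rw [mul_comm]
    exact (norm_sum_le _ _).trans (sum_norm_inner_mul_inner_le b.orthonormal _ _ F)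
  exact key.congr fun F => (h.hasSum_sum_inner b F).tsum_eq

theorem IsNuclearRep.trace_eq [CompleteSpace H] (h : IsNuclearRep T ψ φ) :
    trace T = ∑' n, inner ℂ (φ n) (ψ n) := by
  obtain ⟨b, hb⟩ := (exists_hilbertBasis ℂ H).choose_spec
  rw [trace, ← (h.hasSum_trace b).tsum_eq]
  simp only [hb]

theorem trace_rankOne [CompleteSpace H] (ψ φ : H) :
    trace (InnerProductSpace.rankOne ℂ ψ φ) = inner ℂ φ ψ := by
  simp [(isNuclearRep_rankOne ψ φ).trace_eq]

theorem _root_.Orthonormal.countable [TopologicalSpace.SeparableSpace H] {ι : Type*} {b : ι → H}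
    (hb : Orthonormal ℂ b) : Countable ι := by
  -- Distinct members have distance `√2 > 1`, so the balls of radius `1 / 2` are disjoint.
  refine Pairwise.countable_of_isOpen_disjoint (s := fun i => Metric.ball (b i) (1 / 2)) ?_
    (fun _ => Metric.isOpen_ball) fun i => ⟨b i, Metric.mem_ball_self (by norm_num)⟩
  intro i j hij
  refine Metric.ball_disjoint_ball ?_
  have h : ‖b i - b j‖ ^ 2 = 2 := by
    rw [norm_sub_sq (𝕜 := ℂ), hb.1, hb.1, hb.2 hij]
    norm_num
  rw [dist_eq_norm]
  nlinarith [norm_nonneg (b i - b j)]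

end Nuclear

/-! ### Commutation relations of time-frequency shifts -/

variable {d : ℕ}

theorem translation_modulation (x ω : EuclideanSpace ℝ (Fin d)) (f : L2 d) :
    translation x (modulation ω f) = character ω (-x) • modulation ω (translation x f) := by
  refine Lp.ext ?_
  have h := (measurePreserving_sub_right volume x).quasiMeasurePreserving.ae_eq_comp
    (coeFn_modulation ω f)
  filter_upwards [coeFn_translation x (modulation ω f), h, coeFn_modulation ω (translation x f),
    coeFn_translation x f, Lp.coeFn_smul (character ω (-x)) (modulation ω (translation x f))]
    with t h1 h2 h3 h4 h5
  rw [h1, h5, Pi.smul_apply, h3, h4, smul_eq_mul, ← mul_assoc]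
  refine h2.trans ?_
  simp only [Function.comp_apply, character, ← Complex.exp_add, inner_sub_right, inner_neg_right]
  congr 2
  push_cast
  ring

theorem modulation_comm (ω ω' : EuclideanSpace ℝ (Fin d)) (f : L2 d) :
    modulation ω (modulation ω' f) = modulation ω' (modulation ω f) := by
  refine Lp.ext ?_
  filter_upwards [coeFn_modulation ω (modulation ω' f), coeFn_modulation ω' f,
    coeFn_modulation ω' (modulation ω f), coeFn_modulation ω f] with t h1 h2 h3 h4
  rw [h1, h2, h3, h4, mul_left_comm]

theorem translation_comm (x x' : EuclideanSpace ℝ (Fin d)) (f : L2 d) :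
    translation x (translation x' f) = translation x' (translation x f) := by
  refine Lp.ext ?_
  have h := (measurePreserving_sub_right volume x).quasiMeasurePreserving.ae_eq_comp
    (coeFn_translation x' f)
  have h' := (measurePreserving_sub_right volume x').quasiMeasurePreserving.ae_eq_comp
    (coeFn_translation x f)
  filter_upwards [coeFn_translation x (translation x' f), h,
    coeFn_translation x' (translation x f), h'] with t h1 h2 h3 h4
  simp only [Function.comp_apply] at h2 h4
  rw [h1, h2, h3, h4, sub_right_comm]

theorem tfShift_apply (z : Phase d) (f : L2 d) :
    tfShift z f = modulation z.2 (translation z.1 f) := rfl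

theorem tfShift_tfShift (z y : Phase d) (f : L2 d) :
    tfShift z (tfShift y f) =
      character y.2 (-z.1) •
        modulation z.2 (modulation y.2 (translation z.1 (translation y.1 f))) := by
  rw [tfShift_apply, tfShift_apply, translation_modulation, map_smul]

theorem tfShift_tfShift_neg (z : Phase d) (f : L2 d) :
    tfShift z (tfShift (-z) f) = character z.2 z.1 • f := by
  rw [tfShift_tfShift, Prod.snd_neg, Prod.fst_neg, translation_neg_cancel, modulation_neg_cancel]
  simp [character]

/-- The standard symplectic form `σ((x, ω), (x', ω')) = ω·x' - ω'·x` of phase space. -/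
def symplecticForm : Phase d →ₗ[ℝ] Phase d →ₗ[ℝ] ℝ :=
  LinearMap.mk₂ ℝ (fun y z => inner ℝ y.2 z.1 - inner ℝ z.2 y.1)
    (fun a b c => by simp only [Prod.snd_add, Prod.fst_add, inner_add_left, inner_add_right]; ring)
    (fun r a c => by simp only [Prod.smul_snd, Prod.smul_fst, real_inner_smul_left,
      real_inner_smul_right, smul_eq_mul]; ring)
    (fun a b c => by simp only [Prod.snd_add, Prod.fst_add, inner_add_left, inner_add_right]; ring)
    (fun r a c => by simp only [Prod.smul_snd, Prod.smul_fst, real_inner_smul_left,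
      real_inner_smul_right, smul_eq_mul]; ring)

theorem symplecticForm_apply (y z : Phase d) :
    symplecticForm y z = inner ℝ y.2 z.1 - inner ℝ z.2 y.1 := rfl

theorem continuous_symplecticForm :
    Continuous fun p : Phase d × Phase d => symplecticForm p.1 p.2 := by
  simp only [symplecticForm_apply]
  fun_prop

theorem symplecticForm_ne_zero (y : Phase d) (hy : y ≠ 0) : symplecticForm y ≠ 0 := by
  intro h
  have h1 := LinearMap.congr_fun h (y.2, -y.1)
  rw [symplecticForm_apply, inner_neg_left, LinearMap.zero_apply, real_inner_self_eq_norm_sq,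
    real_inner_self_eq_norm_sq] at h1
  have h2 : ‖y.1‖ = 0 := by nlinarith [sq_nonneg ‖y.1‖, sq_nonneg ‖y.2‖]
  have h3 : ‖y.2‖ = 0 := by nlinarith [sq_nonneg ‖y.1‖, sq_nonneg ‖y.2‖]
  exact hy (Prod.ext (norm_eq_zero.1 h2) (norm_eq_zero.1 h3))

/-- The character `y ↦ exp(2πi σ(y, z))` of phase space. -/
def sympChar (z : Phase d) : BoundedContinuousFunction (Phase d) ℂ :=
  BoundedContinuousFunction.char Real.continuous_fourierChar continuous_symplecticForm z

theorem sympChar_apply (z y : Phase d) :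
    sympChar z y = Complex.exp (2 * Real.pi * Complex.I * (symplecticForm y z : ℝ)) := by
  rw [sympChar, BoundedContinuousFunction.char_apply, Real.fourierChar_apply]
  congr 1
  push_cast
  ring

theorem norm_sympChar_apply (z y : Phase d) : ‖sympChar z y‖ = 1 :=
  Circle.norm_coe _

theorem continuous_sympChar_left (y : Phase d) : Continuous fun z => sympChar z y := by
  simp only [sympChar_apply, symplecticForm_apply]
  fun_prop

theorem tfShift_neg_tfShift_comm (z y : Phase d) (f : L2 d) :
    tfShift (-z) (tfShift y f) = sympChar z y • tfShift y (tfShift (-z) f) := by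
  rw [tfShift_tfShift, tfShift_tfShift, smul_smul, modulation_comm, translation_comm]
  congr 1
  simp only [sympChar_apply, symplecticForm_apply, character, ← Complex.exp_add, Prod.fst_neg,
    Prod.snd_neg, neg_neg, inner_neg_left, inner_neg_right]
  congr 1
  push_cast
  ring

/-! ### The Fourier-Wigner transform of a convolution -/

/-- Conjugation by `π(y)` multiplies the Fourier-Wigner transform by a character:
`π(-z) π(y) = exp(2πi σ(y, z)) π(y) π(-z)`, and the trace is invariant under conjugation. -/
theorem hasSum_trace_tfShift_opShift {N : Type*} {S : L2 d →L[ℂ] L2 d} {ψ φ : N → L2 d}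
    (h : IsNuclearRep S ψ φ) (z y : Phase d) {ι : Type*} (b : HilbertBasis ι ℂ (L2 d)) :
    HasSum (fun i => inner ℂ (b i) (tfShift (-z) (opShift y S (b i))))
      (sympChar z y * trace (tfShift (-z) ∘L S)) := by
  have key := (((h.comp_adjoint (tfShift y)).comp_left (tfShift y)).comp_left
    (tfShift (-z))).hasSum_trace b
  suffices hval : sympChar z y * trace (tfShift (-z) ∘L S) =
      ∑' n, inner ℂ (tfShift y (φ n)) (tfShift (-z) (tfShift y (ψ n))) from hval ▸ key
  rw [(h.comp_left (tfShift (-z))).trace_eq, ← tsum_mul_left]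
  refine tsum_congr fun n => ?_
  rw [tfShift_neg_tfShift_comm, inner_smul_right]
  congr 1
  exact (LinearIsometry.inner_map_map _ _ _).symm

theorem norm_sum_inner_tfShift_opShift_le {N : Type*} {S : L2 d →L[ℂ] L2 d} {ψ φ : N → L2 d}
    (h : IsNuclearRep S ψ φ) (z y : Phase d) {ι : Type*} {b : ι → L2 d} (hb : Orthonormal ℂ b)
    (F : Finset ι) :
    ‖∑ i ∈ F, inner ℂ (b i) (tfShift (-z) (opShift y S (b i)))‖ ≤ ∑' n, ‖ψ n‖ * ‖φ n‖ := by
  have key := (((h.comp_adjoint (tfShift y)).comp_left (tfShift y)).comp_left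
    (tfShift (-z))).norm_sum_inner_le hb F
  simp only [norm_tfShift_apply] at key
  exact key

/-- `tr(π(-z)(f ⋆ S)) = (∫ f(y) exp(2πi σ(y, z)) dy) tr(π(-z) S)`: up to a phase, the
Fourier-Wigner transform turns `f ⋆ S` into the product of the symplectic Fourier transform of `f`
and the Fourier-Wigner transform of `S`. -/
theorem hasSum_trace_tfShift_conv {N : Type*} {S : L2 d →L[ℂ] L2 d} {ψ φ : N → L2 d}
    (h : IsNuclearRep S ψ φ) {f : Phase d → ℂ} (hf : Integrable f volume) (z : Phase d)
    {ι : Type*} (b : HilbertBasis ι ℂ (L2 d)) :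
    HasSum (fun i => inner ℂ (b i) (tfShift (-z) (conv f S (b i))))
      ((∫ y, f y * sympChar z y) * trace (tfShift (-z) ∘L S)) := by
  -- `L²(ℝᵈ)` is separable, so `atTop` on the finite subsets of the basis is countably generated, as
  -- dominated convergence requires.
  have : Fact ((2 : ENNReal) ≠ ⊤) := ⟨by simp⟩
  have : Countable ι := b.orthonormal.countable
  have hspec := fun i => conv_spec hf S (b i) ((tfShift (-z)).adjoint (b i))
  simp only [ContinuousLinearMap.adjoint_inner_left] at hspec
  have key : Tendsto
      (fun F : Finset ι => ∫ y, ∑ i ∈ F, f y * inner ℂ (b i) (tfShift (-z) (opShift y S (b i))))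
      atTop (𝓝 (∫ y, f y * (sympChar z y * trace (tfShift (-z) ∘L S)))) := by
    refine tendsto_integral_filter_of_dominated_convergence
      (fun y => ‖f y‖ * ∑' n, ‖ψ n‖ * ‖φ n‖) ?_ ?_ (hf.norm.mul_const _) ?_
    · exact Eventually.of_forall fun F =>
        (integrable_finsetSum F fun i _ => (hspec i).1).aestronglyMeasurable
    · refine Eventually.of_forall fun F => Eventually.of_forall fun y => ?_
      rw [← Finset.mul_sum, norm_mul]
      gcongr
      exact norm_sum_inner_tfShift_opShift_le h z y b.orthonormal F
    · exact Eventually.of_forall fun y => (hasSum_trace_tfShift_opShift h z y b).mul_left (f y)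
  simp only [← mul_assoc, integral_mul_const] at key
  refine key.congr fun F => ?_
  rw [integral_finsetSum F fun i _ => (hspec i).1]
  exact Finset.sum_congr rfl fun i _ => (hspec i).2.symm

/-! ### Recovering the domain -/

theorem integral_chi_mul {Ω : Set (Phase d)} (hΩ : NullMeasurableSet Ω volume)
    (g : Phase d → ℂ) : ∫ y, chi Ω y * g y = ∫ y in Ω, g y := by
  rw [← integral_indicator₀ hΩ]
  refine integral_congr_ae (Eventually.of_forall fun y => ?_)
  by_cases hy : y ∈ Ω <;> simp [chi, hy]

theorem continuous_integral_sympChar (μ : Measure (Phase d)) [IsFiniteMeasure μ] :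
    Continuous fun z => ∫ y, sympChar z y ∂μ :=
  continuous_of_dominated (bound := fun _ => 1)
    (fun z => (sympChar z).continuous.aestronglyMeasurable)
    (fun z => Eventually.of_forall fun y => (norm_sympChar_apply z y).le)
    (integrable_const _) (Eventually.of_forall continuous_sympChar_left)

/-- A finite measure on phase space is determined by its symplectic Fourier transform on a
dense set. -/
theorem measure_ext_of_integral_sympChar {μ ν : Measure (Phase d)} [IsFiniteMeasure μ]
    [IsFiniteMeasure ν] {D : Set (Phase d)} (hD : Dense D)
    (h : ∀ z ∈ D, ∫ y, sympChar z y ∂μ = ∫ y, sympChar z y ∂ν) : μ = ν := by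
  have hall := Continuous.ext_on hD (continuous_integral_sympChar μ)
    (continuous_integral_sympChar ν) h
  exact ext_of_integral_char_eq Real.continuous_fourierChar Real.fourierChar_ne_one
    symplecticForm_ne_zero continuous_symplecticForm (congrFun hall)

theorem measure_symmDiff_eq_zero_of_restrict_eq {X : Type*} [MeasurableSpace X] {μ : Measure X}
    {s t : Set X} (hs : NullMeasurableSet s μ) (ht : NullMeasurableSet t μ)
    (h : μ.restrict s = μ.restrict t) : μ (s ∆ t) = 0 := by
  have key : ∀ {u v : Set X}, NullMeasurableSet u μ → NullMeasurableSet v μ →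
      μ.restrict u = μ.restrict v → μ (u \ v) = 0 := by
    intro u v hu hv huv
    have huv' : ∀ w, NullMeasurableSet (u \ v) (μ.restrict w) := fun w =>
      (hu.diff hv).mono_ac Measure.restrict_le_self.absolutelyContinuous
    have h1 : μ.restrict u (u \ v) = μ (u \ v) := by
      rw [Measure.restrict_apply₀ (huv' u), Set.inter_eq_left.2 Set.sdiff_subset]
    rw [← h1, huv,
      Measure.restrict_apply₀ (huv' v), Set.sdiff_inter_self, measure_empty]
  rw [Set.symmDiff_def, measure_union_null_iff]
  exact ⟨key hs ht h, key ht hs h.symm⟩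

/-- The uniqueness statement for every operator with a nuclear representation. It covers both trace
class operators and the rank-one operators behind localization operators. -/
theorem measure_symmDiff_eq_zero_of_conv_eq {N : Type*} {S : L2 d →L[ℂ] L2 d} {ψ φ : N → L2 d}
    (h : IsNuclearRep S ψ φ) (hD : Dense {z : Phase d | fourierWigner S z = 0}ᶜ)
    {Ω Ω' : Set (Phase d)} (hΩ : NullMeasurableSet Ω volume) (hfin : volume Ω < ⊤)
    (hΩ' : NullMeasurableSet Ω' volume) (hfin' : volume Ω' < ⊤)
    (heq : conv (chi Ω) S = conv (chi Ω') S) : volume (Ω ∆ Ω') = 0 := by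
  have : IsFiniteMeasure (volume.restrict Ω) := ⟨by simpa using hfin⟩
  have : IsFiniteMeasure (volume.restrict Ω') := ⟨by simpa using hfin'⟩
  refine measure_symmDiff_eq_zero_of_restrict_eq hΩ hΩ'
    (measure_ext_of_integral_sympChar hD fun z hz => ?_)
  have htr : trace (tfShift (-z) ∘L S) ≠ 0 := fun h0 => hz (by
    rw [Set.mem_ofPred_eq, fourierWigner, h0, mul_zero])
  obtain ⟨w, b, -⟩ := exists_hilbertBasis ℂ (L2 d)
  have h1 := hasSum_trace_tfShift_conv h (integrable_chi hΩ hfin) z b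
  rw [heq] at h1
  have h2 := h1.unique (hasSum_trace_tfShift_conv h (integrable_chi hΩ' hfin') z b)
  rw [← integral_chi_mul hΩ, ← integral_chi_mul hΩ']
  exact mul_right_cancel₀ htr h2

/-! ### Localization operators as convolutions -/

/-- A localization operator is the convolution of its symbol with a rank-one operator. -/
theorem localizationOperator_eq_conv (f : Phase d → ℂ) (φ₁ φ₂ : L2 d) :
    localizationOperator f φ₁ φ₂ = conv f (InnerProductSpace.rankOne ℂ φ₂ φ₁) := by
  have h : ∀ z : Phase d, opShift z (InnerProductSpace.rankOne ℂ φ₂ φ₁) =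
      InnerProductSpace.rankOne ℂ (tfShift z φ₂) (tfShift z φ₁) := by
    intro z
    ext1 v
    simp [opShift, InnerProductSpace.rankOne_apply, ContinuousLinearMap.adjoint_inner_right]
  simp only [localizationOperator, conv, h]

/-- The Fourier-Wigner transform of a rank-one operator is a cross-ambiguity function. -/
theorem fourierWigner_rankOne (φ₁ φ₂ : L2 d) (z : Phase d) :
    fourierWigner (InnerProductSpace.rankOne ℂ φ₂ φ₁) z = ambiguity φ₂ φ₁ z := by
  have h1 : tfShift (-z) ∘L InnerProductSpace.rankOne ℂ φ₂ φ₁ =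
      InnerProductSpace.rankOne ℂ (tfShift (-z) φ₂) φ₁ := by
    ext1 v
    simp [InnerProductSpace.rankOne_apply]
  have h2 : inner ℂ φ₁ (tfShift (-z) φ₂) = character z.2 z.1 * inner ℂ (tfShift z φ₁) φ₂ := by
    rw [← inner_smul_right, ← tfShift_tfShift_neg]
    exact (LinearIsometry.inner_map_map _ _ _).symm
  rw [fourierWigner, h1, trace_rankOne, h2, ambiguity, stft, ← mul_assoc, character,
    ← Complex.exp_add, real_inner_comm z.1 z.2]
  congr 2
  ring

end QHA

end

theorem mainTheorem4 (d : ℕ) :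
    (∀ S : QHA.L2 d →L[ℂ] QHA.L2 d, QHA.IsTraceClass S →
      Dense {z : QHA.Phase d | QHA.fourierWigner S z = 0}ᶜ →
      ∀ Ω Ω' : Set (QHA.Phase d),
        NullMeasurableSet Ω volume → volume Ω < ⊤ →
        NullMeasurableSet Ω' volume → volume Ω' < ⊤ →
        QHA.conv (QHA.chi Ω) S = QHA.conv (QHA.chi Ω') S →
        volume (Ω ∆ Ω') = 0) ∧
    (∀ φ₁ φ₂ : QHA.L2 d,
      Dense {z : QHA.Phase d | QHA.ambiguity φ₂ φ₁ z = 0}ᶜ →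
      ∀ Ω Ω' : Set (QHA.Phase d),
        NullMeasurableSet Ω volume → volume Ω < ⊤ →
        NullMeasurableSet Ω' volume → volume Ω' < ⊤ →
        QHA.localizationOperator (QHA.chi Ω) φ₁ φ₂ = QHA.localizationOperator (QHA.chi Ω') φ₁ φ₂ →
        volume (Ω ∆ Ω') = 0) := by
  refine ⟨fun S hS hD Ω Ω' hΩ hfin hΩ' hfin' heq => ?_,
    fun φ₁ φ₂ hD Ω Ω' hΩ hfin hΩ' hfin' heq => ?_⟩
  · obtain ⟨N, ψ, φ, h⟩ := hS.exists_isNuclearRep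
    exact QHA.measure_symmDiff_eq_zero_of_conv_eq h hD hΩ hfin hΩ' hfin' heq
  · rw [QHA.localizationOperator_eq_conv, QHA.localizationOperator_eq_conv] at heq
    refine QHA.measure_symmDiff_eq_zero_of_conv_eq (QHA.isNuclearRep_rankOne φ₂ φ₁) ?_
      hΩ hfin hΩ' hfin' heq
    simpa only [QHA.fourierWigner_rankOne] using hD
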